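/- **Conventions on Lie 2-algebras.** A *Lie 2-algebra* is a 2-term complex of vector spaces $L_0\xleftarrow{d}L_1$ with a bracket, i.e. a chain map $[\cdot,\cdot]\colon L\otimes L\to L$; an *alternator* $S\colon L_0\otimes L_0\to L_1$, a chain homotopy from $[x,y]$ to $-[y,x]$; and an antisymmetric *Jacobiator* $J\colon L_0^{\otimes 3}\to L_1$, a chain homotopy from $[x,[y,z]]$ to $[[x,y],z]+[y,[x,z]]$ (a chain homotopy $T\colon f\Rightarrow g$ satisfies $f+dT+Td=g$), such that for all $w,x,y,z\in L_0$ $$[w,J_{x,y,z}]+J_{w,[x,y],z}+J_{w,y,[x,z]}+[y,J_{w,x,z}]+[J_{w,x,y},z]=J_{w,x,[y,z]}+J_{[w,x],y,z}+[x,J_{w,y,z}]+J_{x,[w,y],z}+J_{x,y,[w,z]},$$ $$[S_{x,y},z]+J_{y,x,z}=-J_{x,y,z},\qquad [x,S_{y,z}]-J_{x,z,y}=J_{x,y,z}+S_{[x,y],z}+S_{y,[x,z]},\qquad S_{x,[y,z]}=S_{[y,z],x}.$$ It is *hemistrict* if $J=0$ and *semistrict* if $S=0$. A *homomorphism* $L\to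 L'$ is a chain map $\phi$ with a chain homotopy $\Phi\colon L_0\otimes L_0\to L_1'$ from $[\phi(x),\phi(y)]'$ to $\phi([x,y])$ such that $$\Phi_{x,y}+\phi(S_{x,y})=S'_{\phi(x),\phi(y)}-\Phi_{y,x},$$ $$J'_{\phi(x),\phi(y),\phi(z)}+[\Phi_{x,y},\phi(z)]'+[\phi(y),\Phi_{x,z}]'+\Phi_{[x,y],z}+\Phi_{y,[x,z]}=[\phi(x),\Phi_{y,z}]'+\Phi_{x,[y,z]}+\phi(J_{x,y,z}).$$ The composite of $(\phi,\Phi)\colon L\to L'$ and $(\psi,\Psi)\colon L'\to L''$ is $\psi\phi$ with the homotopy $\Psi_{\phi(x),\phi(y)}+\psi(\Phi_{x,y})$; the identity homomorphism is the identity chain map with zero homotopy. **Theorem.** Let $(X,\omega)$ be a 2-plectic manifold: a (finite-dimensional, Hausdorff) smooth manifold $X$ with a smooth closed 3-form $\omega$ that is nondegenerate, i.e. $\iota_v\omega=0$ implies $v=0$ for every tangent vector $v$. Let $\mathrm{Ham}(X)$ be the space of smooth 1-forms $F$ for which there is a smooth vector field $v_F$ (necessarily unique) with $dF=-\iota_{v_F}\omega$.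 Then on the complex $\mathrm{Ham}(X)\xleftarrow{d}C^\infty(X)$ the following data define a hemistrict Lie 2-algebra $L(X,\omega)_{\mathrm h}$ and a semistrict Lie 2-algebra $L(X,\omega)_{\mathrm s}$ (for $F,G,H\in\mathrm{Ham}(X)$, $f\in C^\infty(X)$): * $L(X,\omega)_{\mathrm h}$: $\{F,G\}=L_{v_F}G$, $\{F,f\}=L_{v_F}f$, $\{f,F\}=0$, $S_{F,G}=-(\iota_{v_F}G+\iota_{v_G}F)$, $J=0$; * $L(X,\omega)_{\mathrm s}$: $\{F,G\}=\iota_{v_G}\iota_{v_F}\omega$, $\{F,f\}=\{f,F\}=0$, $S=0$, $J_{F,G,H}=-\iota_{v_F}\iota_{v_G}\iota_{v_H}\omega$. These two Lie 2-algebras are isomorphic: there are homomorphisms $\phi\colon L(X,\omega)_{\mathrm h}\to L(X,\omega)_{\mathrm s}$ and $\psi\colon L(X,\omega)_{\mathrm s}\to L(X,\omega)_{\mathrm h}$ whose underlying chain maps are the identity, the chain homotopy of $\phi$ being $\Phi_{F,G}=\iota_{v_F}G$, such that $\psi\circ\phi$ and $\phi\circ\psi$ are the identity homomorphisms. -/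

import Mathlib

open scoped Manifold ContDiff

/-! ### Lie 2-algebras -/

/-- A (weak) Lie 2-algebra over `K` whose underlying 2-term complex is `L₀ ← L₁`.
Everything is written in components: the bracket `L ⊗ L → L` is given by its components
`br00`, `br01`, `br10` on `L₀ ⊗ L₀`, `L₀ ⊗ L₁`, `L₁ ⊗ L₀` (the component on `L₁ ⊗ L₁` lands in
`L₂ = 0`); a chain homotopy `T` from `f` to `g` satisfies `f + d T + T d = g`, and as `L₂ = 0`
the homotopies `S` and `J` are given by their components on 0-chains. -/
@[ext]
structure Lie2Algebra (K : Type*) [Field K] (L₀ L₁ : Type*) [AddCommGroup L₀] [Module K L₀]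
    [AddCommGroup L₁] [Module K L₁] where
  /-- the differential -/
  d : L₁ →ₗ[K] L₀
  /-- the bracket on `L₀ ⊗ L₀` -/
  br00 : L₀ →ₗ[K] L₀ →ₗ[K] L₀
  /-- the bracket on `L₀ ⊗ L₁` -/
  br01 : L₀ →ₗ[K] L₁ →ₗ[K] L₁
  /-- the bracket on `L₁ ⊗ L₀` -/
  br10 : L₁ →ₗ[K] L₀ →ₗ[K] L₁
  /-- the alternator -/
  S : L₀ →ₗ[K] L₀ →ₗ[K] L₁
  /-- the Jacobiator -/
  J : L₀ →ₗ[K] L₀ →ₗ[K] L₀ →ₗ[K] L₁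
  -- the bracket is a chain map (degree 1, then degree 2)
  d_br01 : ∀ x g, d (br01 x g) = br00 x (d g)
  d_br10 : ∀ f y, d (br10 f y) = br00 (d f) y
  br_d_d : ∀ f g, br10 f (d g) = br01 (d f) g
  -- the alternator is a chain homotopy from the bracket to minus the switched bracket
  S00 : ∀ x y, br00 x y + d (S x y) = -br00 y x
  S01 : ∀ x g, br01 x g + S x (d g) = -br10 g x
  S10 : ∀ f y, br10 f y + S (d f) y = -br01 y f
  -- the Jacobiator is a chain homotopy from `[x,[y,z]]` to `[[x,y],z] + [y,[x,z]]`
  J000 : ∀ x y z, br00 x (br00 y z) + d (J x y z) = br00 (br00 x y) z + br00 y (br00 x z)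
  J001 : ∀ x y h, br01 x (br01 y h) + J x y (d h) = br01 (br00 x y) h + br01 y (br01 x h)
  J010 : ∀ x g z, br01 x (br10 g z) + J x (d g) z = br10 (br01 x g) z + br10 g (br00 x z)
  J100 : ∀ f y z, br10 f (br00 y z) + J (d f) y z = br10 (br10 f y) z + br01 y (br10 f z)
  -- the Jacobiator is antisymmetric
  J_swap_left : ∀ x y z, J y x z = -J x y z
  J_swap_right : ∀ x y z, J x z y = -J x y z
  -- the four coherence diagrams
  coh_JJ : ∀ w x y z,
    br01 w (J x y z) + J w (br00 x y) z + J w y (br00 x z) + br01 y (J w x z)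
        + br10 (J w x y) z
      = J w x (br00 y z) + J (br00 w x) y z + br01 x (J w y z) + J x (br00 w y) z
        + J x y (br00 w z)
  coh_SJ_left : ∀ x y z, br10 (S x y) z + J y x z = -J x y z
  coh_SJ_right : ∀ x y z,
    br01 x (S y z) - J x z y = J x y z + (S (br00 x y) z + S y (br00 x z))
  coh_SS : ∀ x y z, S x (br00 y z) - S (br00 y z) x = 0

namespace Lie2Algebra

variable {K : Type*} [Field K]
  {L₀ L₁ M₀ M₁ N₀ N₁ : Type*}
  [AddCommGroup L₀] [Module K L₀] [AddCommGroup L₁] [Module K L₁]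
  [AddCommGroup M₀] [Module K M₀] [AddCommGroup M₁] [Module K M₁]
  [AddCommGroup N₀] [Module K N₀] [AddCommGroup N₁] [Module K N₁]

/-- The Jacobiator is the identity homotopy, i.e. its 1-chains vanish. -/
def IsHemistrict (L : Lie2Algebra K L₀ L₁) : Prop := ∀ x y z, L.J x y z = 0

/-- The alternator is the identity homotopy, i.e. its 1-chains vanish. -/
def IsSemistrict (L : Lie2Algebra K L₀ L₁) : Prop := ∀ x y, L.S x y = 0

/-- A homomorphism of Lie 2-algebras: a chain map `(f₀, f₁)` and a chain homotopy `Φ` from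
`[f -, f -]'` to `f [-, -]` making the two coherence diagrams commute. -/
@[ext]
structure Hom (L : Lie2Algebra K L₀ L₁) (M : Lie2Algebra K M₀ M₁) where
  /-- the chain map in degree 0 -/
  f₀ : L₀ →ₗ[K] M₀
  /-- the chain map in degree 1 -/
  f₁ : L₁ →ₗ[K] M₁
  /-- the chain homotopy -/
  Φ : L₀ →ₗ[K] L₀ →ₗ[K] M₁
  comm : ∀ g, M.d (f₁ g) = f₀ (L.d g)
  Φ00 : ∀ x y, M.br00 (f₀ x) (f₀ y) + M.d (Φ x y) = f₀ (L.br00 x y)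
  Φ01 : ∀ x g, M.br01 (f₀ x) (f₁ g) + Φ x (L.d g) = f₁ (L.br01 x g)
  Φ10 : ∀ g y, M.br10 (f₁ g) (f₀ y) + Φ (L.d g) y = f₁ (L.br10 g y)
  coh_S : ∀ x y, Φ x y + f₁ (L.S x y) = M.S (f₀ x) (f₀ y) - Φ y x
  coh_J : ∀ x y z,
    M.J (f₀ x) (f₀ y) (f₀ z) + (M.br10 (Φ x y) (f₀ z) + M.br01 (f₀ y) (Φ x z))
        + (Φ (L.br00 x y) z + Φ y (L.br00 x z))
      = M.br01 (f₀ x) (Φ y z) + Φ x (L.br00 y z) + f₁ (L.J x y z)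

/-- The identity homomorphism: the identity chain map with the identity homotopy. -/
def Hom.id (L : Lie2Algebra K L₀ L₁) : Hom L L where
  f₀ := LinearMap.id
  f₁ := LinearMap.id
  Φ := 0
  comm := by simp
  Φ00 := by simp
  Φ01 := by simp
  Φ10 := by simp
  coh_S := by simp
  coh_J := by simp

/-- The composite `g ∘ f`: the chain maps are composed, and the homotopy is the pasting
`[g f x, g f y]'' → g [f x, f y]' → g f [x, y]`. -/
def Hom.comp {L : Lie2Algebra K L₀ L₁} {M : Lie2Algebra K M₀ M₁} {N : Lie2Algebra K N₀ N₁}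
    (g : Hom M N) (f : Hom L M) : Hom L N where
  f₀ := g.f₀ ∘ₗ f.f₀
  f₁ := g.f₁ ∘ₗ f.f₁
  Φ := g.Φ.compl₁₂ f.f₀ f.f₀ + f.Φ.compr₂ g.f₁
  comm := by simp [f.comm, g.comm]
  Φ00 x y := by
    have h := g.Φ00 (f.f₀ x) (f.f₀ y)
    have h' := congrArg g.f₀ (f.Φ00 x y)
    simp only [map_add] at h'
    simp [g.comm, ← h', ← h, add_assoc]
  Φ01 x a := by
    have h := g.Φ01 (f.f₀ x) (f.f₁ a)
    have h' := congrArg g.f₁ (f.Φ01 x a)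
    simp only [map_add] at h'
    simp [← h', ← h, add_assoc, f.comm]
  Φ10 a y := by
    have h := g.Φ10 (f.f₁ a) (f.f₀ y)
    have h' := congrArg g.f₁ (f.Φ10 a y)
    simp only [map_add] at h'
    simp [← h', ← h, add_assoc, f.comm]
  coh_S x y := by
    have h := g.coh_S (f.f₀ x) (f.f₀ y)
    have h' := congrArg g.f₁ (f.coh_S x y)
    simp only [map_add, map_sub] at h'
    simp only [LinearMap.add_apply, LinearMap.compl₁₂_apply, LinearMap.compr₂_apply,
      LinearMap.comp_apply, add_assoc, h']
    rw [← add_sub_assoc, h]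
    abel
  coh_J x y z := by
    have h := g.coh_J (f.f₀ x) (f.f₀ y) (f.f₀ z)
    have h' := congrArg g.f₁ (f.coh_J x y z)
    have e₁ := g.Φ10 (f.Φ x y) (f.f₀ z)
    have e₂ := g.Φ01 (f.f₀ y) (f.Φ x z)
    have e₃ := g.Φ01 (f.f₀ x) (f.Φ y z)
    have k₁ := congrArg (fun t => g.Φ t (f.f₀ z)) (f.Φ00 x y)
    have k₂ := congrArg (fun t => g.Φ (f.f₀ y) t) (f.Φ00 x z)
    have k₃ := congrArg (fun t => g.Φ (f.f₀ x) t) (f.Φ00 y z)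
    simp only [map_add, LinearMap.add_apply] at h' k₁ k₂ k₃
    simp only [LinearMap.add_apply, LinearMap.compl₁₂_apply, LinearMap.compr₂_apply,
      LinearMap.comp_apply, map_add, ← k₁, ← k₂, ← k₃]
    rw [← e₁, ← e₂, ← e₃] at h'
    linear_combination (norm := module) h + h'

end Lie2Algebra

/-! ### Differential forms on a manifold -/

noncomputable section

namespace TwoPlectic

variable {E : Type*} [NormedAddCommGroup E] [NormedSpace ℝ E]
  {X : Type*} [TopologicalSpace X] [ChartedSpace E X]

variable (E X) in
/-- Not necessarily smooth `k`-forms on `X`. -/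
abbrev Form (k : ℕ) : Type _ := (x : X) → TangentSpace 𝓘(ℝ, E) x [⋀^Fin k]→L[ℝ] ℝ

variable (E X) in
/-- Smooth real-valued functions on `X`. -/
abbrev SmoothFun : Type _ := ContMDiffMap 𝓘(ℝ, E) 𝓘(ℝ, ℝ) X ℝ ∞

/-- The form `α` read in the chart at `x₀`, i.e. its pullback under the inverse of the chart. -/
def Form.inChart {k : ℕ} (α : Form E X k) (x₀ : X) : E → E [⋀^Fin k]→L[ℝ] ℝ := fun y =>
  (α ((extChartAt 𝓘(ℝ, E) x₀).symm y)).compContinuousLinearMap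
    (mfderiv 𝓘(ℝ, E) 𝓘(ℝ, E) (extChartAt 𝓘(ℝ, E) x₀).symm y)

/-- A form is smooth if its expression in every preferred chart is smooth. -/
def Form.IsSmooth {k : ℕ} (α : Form E X k) : Prop :=
  ∀ x₀ : X, ContDiffOn ℝ ∞ (α.inChart x₀) (extChartAt 𝓘(ℝ, E) x₀).target

/-- The exterior derivative of a form, computed at `x` in the chart at `x`. -/
def Form.extDeriv {k : ℕ} (α : Form E X k) : Form E X (k + 1) := fun x =>
  (_root_.extDeriv (α.inChart x) (extChartAt 𝓘(ℝ, E) x x)).compContinuousLinearMap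
    (mfderiv 𝓘(ℝ, E) 𝓘(ℝ, E) (extChartAt 𝓘(ℝ, E) x) x)

lemma inChart_add {k : ℕ} (α β : Form E X k) (x₀ : X) :
    (α + β).inChart x₀ = α.inChart x₀ + β.inChart x₀ := by
  ext y u; rfl

lemma inChart_smul {k : ℕ} (c : ℝ) (α : Form E X k) (x₀ : X) :
    (c • α).inChart x₀ = c • α.inChart x₀ := by
  ext y u; rfl

lemma Form.IsSmooth.differentiableAt {k : ℕ} {α : Form E X k} (h : α.IsSmooth) (x : X) :
    DifferentiableAt ℝ (α.inChart x) (extChartAt 𝓘(ℝ, E) x x) :=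
  ((h x).contDiffAt ((isOpen_extChartAt_target x).mem_nhds
    (mem_extChartAt_target x))).differentiableAt (by simp)

lemma extDeriv_add {k : ℕ} {α β : Form E X k} (hα : α.IsSmooth) (hβ : β.IsSmooth) :
    (α + β).extDeriv = α.extDeriv + β.extDeriv := by
  funext x
  simp only [Form.extDeriv, inChart_add, Pi.add_apply,
    _root_.extDeriv_add (hα.differentiableAt x) (hβ.differentiableAt x)]
  rfl

lemma extDeriv_smul {k : ℕ} (c : ℝ) (α : Form E X k) :
    (c • α).extDeriv = c • α.extDeriv := by
  funext x
  simp only [Form.extDeriv, inChart_smul, Pi.smul_apply, _root_.extDeriv_smul]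
  rfl

variable [IsManifold 𝓘(ℝ, E) ∞ X]

variable (E X) in
/-- Smooth vector fields on `X`. -/
abbrev VField : Type _ :=
  ContMDiffSection 𝓘(ℝ, E) E ∞ (TangentSpace 𝓘(ℝ, E) : X → Type _)

/-- The interior product `ι_v α = α(v, ·, …, ·)`. -/
def VField.interior {k : ℕ} (v : VField E X) (α : Form E X (k + 1)) : Form E X k := fun x =>
  ContinuousAlternatingMap.curryLeft (E := E) (α x) (v x)

/-- The value of a 0-form at a point. -/
def Form.value (α : Form E X 0) (x : X) : ℝ := α x ![]

/-- The differential of a function, as a 1-form. -/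
def differential (f : X → ℝ) : Form E X 1 := fun x =>
  ContinuousAlternatingMap.ofSubsingleton ℝ (TangentSpace 𝓘(ℝ, E) x) ℝ (0 : Fin 1)
    (mfderiv 𝓘(ℝ, E) 𝓘(ℝ, ℝ) f x)

/-- The Lie derivative `L_v f = df(v)` of a function. -/
def VField.lieDerivFun (v : VField E X) (f : X → ℝ) (x : X) : ℝ :=
  mfderiv 𝓘(ℝ, E) 𝓘(ℝ, ℝ) f x (v x)

/-- The vector field `v` read in the chart at `x₀`. -/
def VField.inChart (v : VField E X) (x₀ : X) : E → E :=
  VectorField.mpullback 𝓘(ℝ, E) 𝓘(ℝ, E) (extChartAt 𝓘(ℝ, E) x₀).symm v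

/-- The Lie derivative `L_v G` of a 1-form, computed at `x` in the chart at `x`, where its
components are `(L_v G)_i = ∑_j (v^j ∂_j G_i + G_j ∂_i v^j)`; this is the derivative at time `0` of
the pullback of `G` along the flow of `v`. -/
def VField.lieDeriv (v : VField E X) (G : Form E X 1) : Form E X 1 := fun x =>
  let p : E := extChartAt 𝓘(ℝ, E) x x
  (fderiv ℝ (G.inChart x) p (v.inChart x p)
      + (G.inChart x p).compContinuousLinearMap (fderiv ℝ (v.inChart x) p)).compContinuousLinearMap
    (mfderiv 𝓘(ℝ, E) 𝓘(ℝ, E) (extChartAt 𝓘(ℝ, E) x) x)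

/-- A 2-plectic structure: a smooth 3-form that is closed and nondegenerate. -/
structure IsTwoPlectic (Ω : Form E X 3) : Prop where
  smooth : Ω.IsSmooth
  closed : Ω.extDeriv = 0
  nondegenerate : ∀ (x : X) (v : TangentSpace 𝓘(ℝ, E) x),
    ContinuousAlternatingMap.curryLeft (E := E) (Ω x) v = 0 → v = 0

/-! ### Hamiltonian 1-forms -/

/-- `v` is a Hamiltonian vector field of `F`: `dF = - ι_v Ω`. -/
def IsHamiltonianVF (Ω : Form E X 3) (F : Form E X 1) (v : VField E X) : Prop :=
  F.extDeriv = -v.interior Ω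

/-- The vector space `Ham(X)` of Hamiltonian (smooth) 1-forms. -/
def Ham (Ω : Form E X 3) : Submodule ℝ (Form E X 1) where
  carrier := {F | F.IsSmooth ∧ ∃ v : VField E X, IsHamiltonianVF Ω F v}
  zero_mem' := by
    have hz : (0 : Form E X 1) = (0 : ℝ) • (0 : Form E X 1) := by simp
    refine ⟨fun x₀ => ?_, 0, ?_⟩
    · rw [hz, inChart_smul, zero_smul]
      exact contDiffOn_const
    · unfold IsHamiltonianVF
      rw [hz, extDeriv_smul, zero_smul]
      funext x
      exact (neg_eq_zero.2 (map_zero (ContinuousAlternatingMap.curryLeft (E := E) (Ω x)))).symm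
  add_mem' := by
    rintro F G ⟨hF, v, hv⟩ ⟨hG, w, hw⟩
    refine ⟨fun x₀ => ?_, v + w, ?_⟩
    · rw [inChart_add]
      exact (hF x₀).add (hG x₀)
    · unfold IsHamiltonianVF at *
      rw [extDeriv_add hF hG, hv, hw, ← neg_add]
      funext x
      exact congrArg Neg.neg
        (map_add (ContinuousAlternatingMap.curryLeft (E := E) (Ω x)) (v x) (w x)).symm
  smul_mem' := by
    rintro c F ⟨hF, v, hv⟩
    refine ⟨fun x₀ => ?_, c • v, ?_⟩
    · rw [inChart_smul]
      exact contDiffOn_const.smul (hF x₀)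
    · unfold IsHamiltonianVF at *
      rw [extDeriv_smul, hv, smul_neg]
      funext x
      exact congrArg Neg.neg
        (map_smul (ContinuousAlternatingMap.curryLeft (E := E) (Ω x)) c (v x)).symm

/-- The Hamiltonian vector field `v_F`; it is unique when `Ω` is nondegenerate. -/
def hamVF {Ω : Form E X 3} (F : Ham Ω) : VField E X := F.2.2.choose

/-- `L` is the Lie 2-algebra `L(X,Ω)_h`: its differential, brackets, alternator and Jacobiator
(that is, all its data) are the prescribed ones. -/
structure IsHemistrictLie2 (Ω : Form E X 3) (L : Lie2Algebra ℝ (Ham Ω) (SmoothFun E X)) :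
    Prop where
  d_eq : ∀ f, (L.d f : Form E X 1) = differential f
  br00_eq : ∀ F G : Ham Ω, (L.br00 F G : Form E X 1) = (hamVF F).lieDeriv G
  br01_eq : ∀ (F : Ham Ω) f x, L.br01 F f x = (hamVF F).lieDerivFun f x
  br10_eq : ∀ f (F : Ham Ω), L.br10 f F = 0
  S_eq : ∀ (F G : Ham Ω) x,
    L.S F G x = -(((hamVF F).interior (G : Form E X 1)).value x
      + ((hamVF G).interior (F : Form E X 1)).value x)
  J_eq : L.IsHemistrict

/-- `L` is the Lie 2-algebra `L(X,Ω)_s`: its differential, brackets, alternator and Jacobiator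
(that is, all its data) are the prescribed ones. -/
structure IsSemistrictLie2 (Ω : Form E X 3) (L : Lie2Algebra ℝ (Ham Ω) (SmoothFun E X)) :
    Prop where
  d_eq : ∀ f, (L.d f : Form E X 1) = differential f
  br00_eq : ∀ F G : Ham Ω,
    (L.br00 F G : Form E X 1) = (hamVF G).interior ((hamVF F).interior Ω)
  br01_eq : ∀ (F : Ham Ω) f, L.br01 F f = 0
  br10_eq : ∀ f (F : Ham Ω), L.br10 f F = 0
  S_eq : L.IsSemistrict
  J_eq : ∀ (F G H : Ham Ω) x,
    L.J F G H x
      = -((hamVF F).interior ((hamVF G).interior ((hamVF H).interior Ω))).value x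

end TwoPlectic

end

/-!
Since `d ω = 0` and `ι_{v_F} ω = -dF`, Cartan's formula gives `L_{v_F} ω = 0`; hence `L_{v_F} G` is
Hamiltonian with vector field `[v_F, v_G]`, and the axioms of the hemistrict Lie 2-algebra become
Cartan identities.

A bilinear map `Φ : L₀ ⊗ L₀ → L₁` on any Lie 2-algebra transports its structure along the identity
chain map with the homotopy `Φ`. The transported structure inherits all axioms except possibly the
antisymmetry of its Jacobiator. For the hemistrict algebra and `Φ_{F,G} = ι_{v_F} G`, that
Jacobiator is `ι_{v_F} ι_{v_G} dH = -ι_{v_F} ι_{v_G} ι_{v_H} ω`, which is antisymmetric, and the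
transported structure is the semistrict Lie 2-algebra.
-/

/-! ### Transport of a Lie 2-algebra along a homotopy -/

namespace Lie2Algebra

section Twist

variable {K : Type*} [Field K] {L₀ L₁ : Type*} [AddCommGroup L₀] [Module K L₀]
  [AddCommGroup L₁] [Module K L₁] (L : Lie2Algebra K L₀ L₁) (Φ : L₀ →ₗ[K] L₀ →ₗ[K] L₁)

/-- The bracket on `L₀ ⊗ L₀` from which `Φ` is a chain homotopy to that of `L`. -/
def twistBr00 : L₀ →ₗ[K] L₀ →ₗ[K] L₀ := L.br00 - Φ.compr₂ L.d

/-- The bracket on `L₀ ⊗ L₁` accompanying `twistBr00`. -/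
def twistBr01 : L₀ →ₗ[K] L₁ →ₗ[K] L₁ := L.br01 - Φ.compl₂ L.d

/-- The bracket on `L₁ ⊗ L₀` accompanying `twistBr00`. -/
def twistBr10 : L₁ →ₗ[K] L₀ →ₗ[K] L₁ := L.br10 - Φ ∘ₗ L.d

@[simp]
lemma twistBr00_apply (x y : L₀) : L.twistBr00 Φ x y = L.br00 x y - L.d (Φ x y) := rfl

@[simp]
lemma twistBr01_apply (x : L₀) (g : L₁) : L.twistBr01 Φ x g = L.br01 x g - Φ x (L.d g) := rfl

@[simp]
lemma twistBr10_apply (g : L₁) (y : L₀) : L.twistBr10 Φ g y = L.br10 g y - Φ (L.d g) y := rfl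

/-- The only Jacobiator for the twisted bracket with which the identity chain map and the homotopy
`Φ` are coherent, see `twistJ_apply`. -/
def twistJ : L₀ →ₗ[K] L₀ →ₗ[K] L₀ →ₗ[K] L₁ :=
  LinearMap.mk₂ K (fun x y => L.J x y + L.twistBr01 Φ x ∘ₗ Φ y + Φ x ∘ₗ L.br00 y
    - L.twistBr10 Φ (Φ x y) - L.twistBr01 Φ y ∘ₗ Φ x - Φ (L.br00 x y) - Φ y ∘ₗ L.br00 x)
    (fun _ _ _ => by
      ext
      simp only [map_add, twistBr01_apply, twistBr10_apply,
        LinearMap.add_apply, LinearMap.sub_apply, LinearMap.comp_apply]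
      module)
    (fun _ _ _ => by
      ext
      simp only [map_smul, twistBr01_apply, twistBr10_apply,
        LinearMap.add_apply, LinearMap.sub_apply, LinearMap.smul_apply, LinearMap.comp_apply]
      module)
    (fun _ _ _ => by
      ext
      simp only [map_add, twistBr01_apply, twistBr10_apply,
        LinearMap.add_apply, LinearMap.sub_apply, LinearMap.comp_apply]
      module)
    (fun _ _ _ => by
      ext
      simp only [map_smul, twistBr01_apply, twistBr10_apply,
        LinearMap.add_apply, LinearMap.sub_apply, LinearMap.smul_apply, LinearMap.comp_apply]
      module)

lemma twistJ_apply (x y z : L₀) : L.twistJ Φ x y z =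
    L.J x y z + L.twistBr01 Φ x (Φ y z) + Φ x (L.br00 y z) - L.twistBr10 Φ (Φ x y) z
      - L.twistBr01 Φ y (Φ x z) - Φ (L.br00 x y) z - Φ y (L.br00 x z) := rfl

lemma twistJ_coh (w x y z : L₀) :
    L.twistBr01 Φ w (L.twistJ Φ x y z) + L.twistJ Φ w (L.twistBr00 Φ x y) z
        + L.twistJ Φ w y (L.twistBr00 Φ x z) + L.twistBr01 Φ y (L.twistJ Φ w x z)
        + L.twistBr10 Φ (L.twistJ Φ w x y) z =
      L.twistJ Φ w x (L.twistBr00 Φ y z) + L.twistJ Φ (L.twistBr00 Φ w x) y z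
        + L.twistBr01 Φ x (L.twistJ Φ w y z) + L.twistJ Φ x (L.twistBr00 Φ w y) z
        + L.twistJ Φ x y (L.twistBr00 Φ w z) := by
  have jac_w := congrArg (Φ w) (L.J000 x y z)
  have jac_x := congrArg (Φ x) (L.J000 w y z)
  have jac_y := congrArg (Φ y) (L.J000 w x z)
  have jac_z := congrArg (Φ · z) (L.J000 w x y)
  simp only [map_add, LinearMap.add_apply] at jac_w jac_x jac_y jac_z
  simp only [twistJ_apply, twistBr00_apply, twistBr01_apply, twistBr10_apply, map_add, map_sub,
    LinearMap.add_apply, LinearMap.sub_apply, L.d_br01, L.d_br10, L.br_d_d]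
  linear_combination (norm := abel) L.coh_JJ w x y z
    + L.J001 w x (Φ y z) - L.J001 w y (Φ x z) + L.J001 x y (Φ w z)
    - L.J010 w (Φ x y) z + L.J010 x (Φ w y) z + L.J100 (Φ w x) y z
    - jac_w + jac_x - jac_y - jac_z

/-- The Lie 2-algebra to which the identity chain map with the homotopy `Φ` transports the
structure of `L`. Its Jacobiator is antisymmetric only for special `Φ`. -/
@[simps]
def twist (swap_left : ∀ x y z, L.twistJ Φ y x z = -L.twistJ Φ x y z)
    (swap_right : ∀ x y z, L.twistJ Φ x z y = -L.twistJ Φ x y z) : Lie2Algebra K L₀ L₁ where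
  d := L.d
  br00 := L.twistBr00 Φ
  br01 := L.twistBr01 Φ
  br10 := L.twistBr10 Φ
  S := L.S + Φ + Φ.flip
  J := L.twistJ Φ
  d_br01 x g := by simp [L.d_br01]
  d_br10 f y := by simp [L.d_br10]
  br_d_d f g := by simp [L.br_d_d]
  S00 x y := by
    simp only [twistBr00_apply, LinearMap.add_apply, LinearMap.flip_apply, map_add]
    linear_combination (norm := abel) L.S00 x y
  S01 x g := by
    simp only [twistBr01_apply, twistBr10_apply, LinearMap.add_apply, LinearMap.flip_apply]
    linear_combination (norm := abel) L.S01 x g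
  S10 f y := by
    simp only [twistBr01_apply, twistBr10_apply, LinearMap.add_apply, LinearMap.flip_apply]
    linear_combination (norm := abel) L.S10 f y
  J000 x y z := by
    simp only [twistJ_apply, twistBr00_apply, twistBr01_apply, twistBr10_apply, map_add, map_sub,
      LinearMap.sub_apply, L.d_br01, L.d_br10]
    linear_combination (norm := abel) L.J000 x y z
  J001 x y g := by
    simp only [twistJ_apply, twistBr00_apply, twistBr01_apply, twistBr10_apply, map_sub,
      LinearMap.sub_apply, L.d_br01, L.br_d_d]
    linear_combination (norm := abel) L.J001 x y g
  J010 x g z := by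
    simp only [twistJ_apply, twistBr00_apply, twistBr01_apply, twistBr10_apply, map_sub,
      LinearMap.sub_apply, L.d_br01, L.d_br10, L.br_d_d]
    linear_combination (norm := abel) L.J010 x g z
  J100 f y z := by
    simp only [twistJ_apply, twistBr00_apply, twistBr01_apply, twistBr10_apply, map_sub,
      LinearMap.sub_apply, L.d_br10, L.br_d_d]
    linear_combination (norm := abel) L.J100 f y z
  J_swap_left := swap_left
  J_swap_right := swap_right
  coh_JJ := L.twistJ_coh Φ
  coh_SJ_left x y z := by
    have switch := congrArg (Φ · z) (L.S00 x y)
    simp only [map_add, map_neg, LinearMap.add_apply, LinearMap.neg_apply] at switch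
    simp only [twistJ_apply, twistBr10_apply, map_add, LinearMap.add_apply, LinearMap.flip_apply]
    linear_combination (norm := abel) L.coh_SJ_left x y z - switch
  coh_SJ_right x y z := by
    have switch := congrArg (Φ x) (L.S00 y z)
    simp only [map_add, map_neg] at switch
    simp only [twistJ_apply, twistBr00_apply, twistBr01_apply, twistBr10_apply, map_add, map_sub,
      LinearMap.add_apply, LinearMap.sub_apply, LinearMap.flip_apply]
    linear_combination (norm := abel) L.coh_SJ_right x y z + L.S10 (Φ x y) z + L.S01 y (Φ x z)
      - switch
  coh_SS x y z := by
    simp only [twistBr00_apply, map_sub, LinearMap.add_apply, LinearMap.sub_apply,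
      LinearMap.flip_apply]
    linear_combination (norm := abel) L.coh_SS x y z + L.S10 (Φ y z) x - L.S01 x (Φ y z)

variable {L Φ} (swap_left : ∀ x y z, L.twistJ Φ y x z = -L.twistJ Φ x y z)
  (swap_right : ∀ x y z, L.twistJ Φ x z y = -L.twistJ Φ x y z)

/-- The identity chain map with the homotopy `Φ`, as a homomorphism from `L` to its twist. -/
def toTwist : Hom L (L.twist Φ swap_left swap_right) where
  f₀ := LinearMap.id
  f₁ := LinearMap.id
  Φ := Φ
  comm _ := rfl
  Φ00 := by simp
  Φ01 := by simp
  Φ10 := by simp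
  coh_S x y := by
    simp only [twist_S, LinearMap.add_apply, LinearMap.flip_apply, LinearMap.id_apply]
    abel
  coh_J x y z := by
    simp only [twist_J, twist_br01, twist_br10, twistJ_apply, LinearMap.id_apply]
    abel

/-- The identity chain map with the homotopy `-Φ`, as a homomorphism to `L` from its twist. -/
def ofTwist : Hom (L.twist Φ swap_left swap_right) L where
  f₀ := LinearMap.id
  f₁ := LinearMap.id
  Φ := -Φ
  comm _ := rfl
  Φ00 := by simp [sub_eq_add_neg]
  Φ01 := by simp [sub_eq_add_neg]
  Φ10 := by simp [sub_eq_add_neg]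
  coh_S x y := by
    simp only [twist_S, LinearMap.add_apply, LinearMap.flip_apply, LinearMap.id_apply,
      LinearMap.neg_apply]
    abel
  coh_J x y z := by
    simp only [twist_J, twist_br00, twistJ_apply, twistBr00_apply, twistBr01_apply,
      twistBr10_apply, LinearMap.id_apply, LinearMap.neg_apply, LinearMap.sub_apply, map_neg,
      map_sub]
    abel

lemma ofTwist_comp_toTwist :
    (ofTwist swap_left swap_right).comp (toTwist swap_left swap_right) = Hom.id L := by
  ext <;> simp [Hom.comp, Hom.id, toTwist, ofTwist]

lemma toTwist_comp_ofTwist :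
    (toTwist swap_left swap_right).comp (ofTwist swap_left swap_right) = Hom.id _ := by
  ext <;> simp [Hom.comp, Hom.id, toTwist, ofTwist]

end Twist
end Lie2Algebra

/-! ### The Lie derivative on a normed space -/

noncomputable section

namespace TwoPlectic

open ContinuousAlternatingMap VectorField Filter Topology

section NormedSpace

variable {𝕜 E F : Type*} [NontriviallyNormedField 𝕜] [NormedAddCommGroup E] [NormedSpace 𝕜 E]
  [NormedAddCommGroup F] [NormedSpace 𝕜 F] {k : ℕ}

lemma curryLeft_curryLeft_swap (T : E [⋀^Fin (k + 2)]→L[𝕜] F) (a b : E) :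
    curryLeft (curryLeft T a) b = -curryLeft (curryLeft T b) a := by
  have h := curryLeft_same T (a + b)
  simp only [map_add, curryLeft_add, _root_.add_apply, curryLeft_same, zero_add, add_zero] at h
  exact eq_neg_of_add_eq_zero_right h

lemma curryLeft_alternatizeUncurryFin (f : E →L[𝕜] E [⋀^Fin (k + 1)]→L[𝕜] F) (x : E) :
    curryLeft (alternatizeUncurryFin f) x =
      f x - alternatizeUncurryFin ((curryLeftLI.toContinuousLinearMap ∘L f).flip x) := by
  ext u
  have removeNth_succ (i : Fin (k + 1)) :
      i.succ.removeNth (Matrix.vecCons x u) = Matrix.vecCons x (i.removeNth u) := by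
    ext j
    cases j using Fin.cases <;> simp [Fin.removeNth]
  simp [alternatizeUncurryFin_apply, Fin.sum_univ_succ (n := k + 1), removeNth_succ, pow_succ,
    sub_eq_add_neg]

lemma curryLeft_fderivCompContinuousLinearMap_id (T : E [⋀^Fin (k + 1)]→L[𝕜] F) (A : E →L[𝕜] E)
    (x : E) :
    curryLeft (T.fderivCompContinuousLinearMap (.id 𝕜 E) A) x =
      curryLeft T (A x) + (curryLeft T x).fderivCompContinuousLinearMap (.id 𝕜 E) A := by
  ext u
  have first : (fun j => Function.update (fun _ => ContinuousLinearMap.id 𝕜 E) 0 A j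
      (Matrix.vecCons x u j)) = Matrix.vecCons (A x) u := by
    ext j
    cases j using Fin.cases <;> simp
  have succ (i : Fin k) : (fun j => Function.update (fun _ => ContinuousLinearMap.id 𝕜 E) i.succ A j
      (Matrix.vecCons x u j)) = Matrix.vecCons x fun j =>
        Function.update (fun _ => ContinuousLinearMap.id 𝕜 E) i A j (u j) := by
    ext j
    cases j using Fin.cases <;> simp [Function.update_apply, (Fin.succ_ne_zero i).symm]
  simp [fderivCompContinuousLinearMap_apply, Fin.sum_univ_succ, first, succ]

variable {α : E → E [⋀^Fin k]→L[𝕜] F} {β : E → E [⋀^Fin (k + 1)]→L[𝕜] F} {v w : E → E} {p : E}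

lemma hasFDerivAt_curryLeft {β' : E →L[𝕜] E [⋀^Fin (k + 1)]→L[𝕜] F} {v' : E →L[𝕜] E}
    (hβ : HasFDerivAt β β' p) (hv : HasFDerivAt v v' p) :
    HasFDerivAt (fun y => curryLeft (β y) (v y))
      (curryLeft (β p) ∘L v' + (curryLeftLI.toContinuousLinearMap ∘L β').flip (v p)) p := by
  let L : (E [⋀^Fin (k + 1)]→L[𝕜] F) →L[𝕜] E →L[𝕜] E [⋀^Fin k]→L[𝕜] F :=
    curryLeftLI.toContinuousLinearMap
  exact HasFDerivAt.clm_apply (c := fun y => L (β y)) (L.hasFDerivAt.comp p hβ) hv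

lemma contDiffOn_curryLeft {s : Set E} {n : WithTop ℕ∞} (hβ : ContDiffOn 𝕜 n β s)
    (hv : ContDiffOn 𝕜 n v s) : ContDiffOn 𝕜 n (fun y => curryLeft (β y) (v y)) s := by
  let L : (E [⋀^Fin (k + 1)]→L[𝕜] F) →L[𝕜] E →L[𝕜] E [⋀^Fin k]→L[𝕜] F :=
    curryLeftLI.toContinuousLinearMap
  exact (L.contDiff.comp_contDiffOn hβ).clm_apply hv

lemma contDiffOn_extDeriv {s : Set E} {m n : WithTop ℕ∞} (hα : ContDiffOn 𝕜 n α s) (hs : IsOpen s)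
    (hmn : m + 1 ≤ n) : ContDiffOn 𝕜 m (extDeriv α) s := by
  have h := (alternatizeUncurryFinCLM 𝕜 E F (n := k)).contDiff.comp_contDiffOn
    (hα.fderiv_of_isOpen hs hmn)
  exact h

/-- The Lie derivative of a differential form `α` on a normed space along a vector field `v`:
`∑ⱼ vʲ ∂ⱼα` plus the sum over the slots of `α` of the insertions of `Dv` into that slot (the
derivative of `α ∘ (g × ⋯ × g)` in `g`, at the identity and in the direction `Dv`). -/
def flatLieDeriv (v : E → E) (α : E → E [⋀^Fin k]→L[𝕜] F) (p : E) : E [⋀^Fin k]→L[𝕜] F :=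
  fderiv 𝕜 α p (v p) + (α p).fderivCompContinuousLinearMap (.id 𝕜 E) (fderiv 𝕜 v p)

lemma flatLieDeriv_eq_curryLeft_extDeriv (v : E → E) (α : E → E [⋀^Fin 0]→L[𝕜] F) (p : E) :
    flatLieDeriv v α p = curryLeft (extDeriv α p) (v p) := by
  ext u
  simp [flatLieDeriv, fderivCompContinuousLinearMap_of_isEmpty, extDeriv,
    alternatizeUncurryFin_apply, Subsingleton.elim _ u]

lemma flatLieDeriv_eq_add (hβ : DifferentiableAt 𝕜 β p) (hv : DifferentiableAt 𝕜 v p) :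
    flatLieDeriv v β p =
      curryLeft (extDeriv β p) (v p) + extDeriv (fun y => curryLeft (β y) (v y)) p := by
  have slots : (β p).fderivCompContinuousLinearMap (.id 𝕜 E) (fderiv 𝕜 v p) =
      alternatizeUncurryFin (curryLeft (β p) ∘L fderiv 𝕜 v p) := by
    rw [fderivCompContinuousLinearMap_eq_alternatizeUncurryFin]
    rfl
  rw [flatLieDeriv, slots, extDeriv, extDeriv, curryLeft_alternatizeUncurryFin,
    (hasFDerivAt_curryLeft hβ.hasFDerivAt hv.hasFDerivAt).fderiv, alternatizeUncurryFin_add]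
  abel

lemma flatLieDeriv_curryLeft (hβ : DifferentiableAt 𝕜 β p) (hw : DifferentiableAt 𝕜 w p) :
    flatLieDeriv v (fun y => curryLeft (β y) (w y)) p =
      curryLeft (β p) (lieBracket 𝕜 v w p) + curryLeft (flatLieDeriv v β p) (w p) := by
  simp only [flatLieDeriv, lieBracket_eq, curryLeft_add, map_sub, _root_.add_apply,
    (hasFDerivAt_curryLeft hβ.hasFDerivAt hw.hasFDerivAt).fderiv,
    curryLeft_fderivCompContinuousLinearMap_id, ContinuousLinearMap.comp_apply,
    ContinuousLinearMap.flip_apply, LinearIsometry.coe_toContinuousLinearMap,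
    curryLeftLI_apply]
  abel

end NormedSpace

/-! ### Cartan calculus on a manifold -/

variable {E : Type*} [NormedAddCommGroup E] [NormedSpace ℝ E]
  {X : Type*} [TopologicalSpace X] [ChartedSpace E X] {k : ℕ}

variable {E : Type*} [NormedAddCommGroup E] [NormedSpace ℝ E]
  {X : Type*} [TopologicalSpace X] [ChartedSpace E X] {k : ℕ}

section Form

lemma minSmoothness_two_le_infty : minSmoothness ℝ 2 ≤ (∞ : WithTop ℕ∞) := by
  simpa using WithTop.coe_le_coe.2 (le_top : (2 : ℕ∞) ≤ ⊤)

lemma Form.apply_congr (α : Form E X k) {x x' : X} (h : x = x') (u : Fin k → E) :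
    (α x : (Fin k → E) → ℝ) u = (α x' : (Fin k → E) → ℝ) u := by
  subst h; rfl

lemma Form.IsSmooth.differentiableAt_inChart {α : Form E X k} (hα : α.IsSmooth) {x₀ : X} {y : E}
    (hy : y ∈ (extChartAt 𝓘(ℝ, E) x₀).target) : DifferentiableAt ℝ (α.inChart x₀) y :=
  ((hα x₀).contDiffAt ((isOpen_extChartAt_target x₀).mem_nhds hy)).differentiableAt (by simp)

lemma Form.IsSmooth.add {α β : Form E X k} (hα : α.IsSmooth) (hβ : β.IsSmooth) :
    (α + β).IsSmooth := fun x₀ => by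
  rw [inChart_add]
  exact (hα x₀).add (hβ x₀)

@[simp]
lemma extDeriv_zero : (0 : Form E X k).extDeriv = 0 := by
  rw [← zero_smul ℝ (0 : Form E X k), extDeriv_smul, zero_smul]

lemma extDeriv_neg (α : Form E X k) : (-α).extDeriv = -α.extDeriv :=
  (congrArg Form.extDeriv (neg_one_smul ℝ α).symm).trans <|
    (extDeriv_smul (-1) α).trans (neg_one_smul ℝ α.extDeriv)

variable [IsManifold 𝓘(ℝ, E) ∞ X] {x₀ x₁ x : X} {y : E}

lemma contMDiffAt_extChartAt_symm (hy : y ∈ (extChartAt 𝓘(ℝ, E) x₀).target) :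
    ContMDiffAt 𝓘(ℝ, E) 𝓘(ℝ, E) ∞ (extChartAt 𝓘(ℝ, E) x₀).symm y :=
  (contMDiffOn_extChartAt_symm x₀).contMDiffAt ((isOpen_extChartAt_target x₀).mem_nhds hy)

lemma mdifferentiableAt_extChartAt_symm (hy : y ∈ (extChartAt 𝓘(ℝ, E) x₀).target) :
    MDifferentiableAt 𝓘(ℝ, E) 𝓘(ℝ, E) (extChartAt 𝓘(ℝ, E) x₀).symm y :=
  (contMDiffAt_extChartAt_symm hy).mdifferentiableAt (by simp)

lemma isInvertible_mfderiv_extChartAt_symm (hy : y ∈ (extChartAt 𝓘(ℝ, E) x₀).target) :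
    (mfderiv 𝓘(ℝ, E) 𝓘(ℝ, E) (extChartAt 𝓘(ℝ, E) x₀).symm y).IsInvertible := by
  simpa using isInvertible_mfderivWithin_extChartAt_symm hy

lemma mfderiv_extChartAt_symm_mfderiv_extChartAt (hx : x ∈ (extChartAt 𝓘(ℝ, E) x₀).source)
    (u : TangentSpace 𝓘(ℝ, E) x) :
    mfderiv 𝓘(ℝ, E) 𝓘(ℝ, E) (extChartAt 𝓘(ℝ, E) x₀).symm (extChartAt 𝓘(ℝ, E) x₀ x)
      (mfderiv 𝓘(ℝ, E) 𝓘(ℝ, E) (extChartAt 𝓘(ℝ, E) x₀) x u) = u := by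
  have h := mfderivWithin_extChartAt_symm_comp_mfderiv_extChartAt' hx
  rw [modelWithCornersSelf_coe, Set.range_id, mfderivWithin_univ] at h
  exact DFunLike.congr_fun h u

lemma Form.apply_eq_inChart (α : Form E X k) (x : X) :
    α x = (α.inChart x (extChartAt 𝓘(ℝ, E) x x)).compContinuousLinearMap
      (mfderiv 𝓘(ℝ, E) 𝓘(ℝ, E) (extChartAt 𝓘(ℝ, E) x) x) := by
  ext u
  refine (congrArg (α := Fin k → E) (α x) (funext fun i => ?_)).trans
    (α.apply_congr (extChartAt_to_inv (I := 𝓘(ℝ, E)) x).symm _)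
  exact (mfderiv_extChartAt_symm_mfderiv_extChartAt
    (mem_extChartAt_source (I := 𝓘(ℝ, E)) x) _).symm

lemma Form.ext_inChart {α β : Form E X k}
    (h : ∀ x, α.inChart x (extChartAt 𝓘(ℝ, E) x x) = β.inChart x (extChartAt 𝓘(ℝ, E) x x)) :
    α = β := by
  funext x
  rw [α.apply_eq_inChart, β.apply_eq_inChart, h]

/-- The transition map from the chart at `x₀` to the chart at `x₁`. -/
def transition (x₀ x₁ : X) : E → E := extChartAt 𝓘(ℝ, E) x₁ ∘ (extChartAt 𝓘(ℝ, E) x₀).symm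

lemma contDiffAt_transition (hy : y ∈ (extChartAt 𝓘(ℝ, E) x₀).target)
    (hy₁ : (extChartAt 𝓘(ℝ, E) x₀).symm y ∈ (extChartAt 𝓘(ℝ, E) x₁).source) :
    ContDiffAt ℝ ∞ (transition x₀ x₁ : E → E) y := by
  rw [← contMDiffAt_iff_contDiffAt]
  exact (contMDiffAt_extChartAt' (by rwa [extChartAt_source] at hy₁)).comp y
    (contMDiffAt_extChartAt_symm hy)

lemma fderiv_transition (hy : y ∈ (extChartAt 𝓘(ℝ, E) x₀).target)
    (hy₁ : (extChartAt 𝓘(ℝ, E) x₀).symm y ∈ (extChartAt 𝓘(ℝ, E) x₁).source) (u : E) :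
    fderiv ℝ (transition x₀ x₁ : E → E) y u =
      mfderiv 𝓘(ℝ, E) 𝓘(ℝ, E) (extChartAt 𝓘(ℝ, E) x₁) ((extChartAt 𝓘(ℝ, E) x₀).symm y)
        (mfderiv 𝓘(ℝ, E) 𝓘(ℝ, E) (extChartAt 𝓘(ℝ, E) x₀).symm y u) := by
  rw [← mfderiv_eq_fderiv]
  have hx₁ : MDifferentiableAt 𝓘(ℝ, E) 𝓘(ℝ, E) (extChartAt 𝓘(ℝ, E) x₁)
      ((extChartAt 𝓘(ℝ, E) x₀).symm y) :=
    mdifferentiableAt_extChartAt (by rwa [extChartAt_source] at hy₁)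
  exact DFunLike.congr_fun (mfderiv_comp y hx₁ (mdifferentiableAt_extChartAt_symm hy)) u

lemma Form.inChart_transition (α : Form E X k) (hy : y ∈ (extChartAt 𝓘(ℝ, E) x₀).target)
    (hy₁ : (extChartAt 𝓘(ℝ, E) x₀).symm y ∈ (extChartAt 𝓘(ℝ, E) x₁).source) :
    α.inChart x₀ y = (α.inChart x₁ (transition x₀ x₁ y)).compContinuousLinearMap
      (fderiv ℝ (transition x₀ x₁ : E → E) y) := by
  ext u
  refine Eq.trans ?_ (α.apply_congr ((extChartAt 𝓘(ℝ, E) x₁).left_inv hy₁).symm _)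
  refine congrArg (α ((extChartAt 𝓘(ℝ, E) x₀).symm y) : (Fin k → E) → ℝ) (funext fun i => ?_)
  refine (mfderiv_extChartAt_symm_mfderiv_extChartAt hy₁ _).symm.trans ?_
  exact congrArg (fun w : E => (mfderiv 𝓘(ℝ, E) 𝓘(ℝ, E) (extChartAt 𝓘(ℝ, E) x₁).symm
    (transition x₀ x₁ y) w : E)) (fderiv_transition hy hy₁ (u i)).symm

lemma Form.IsSmooth.inChart_extDeriv {α : Form E X k} (hα : α.IsSmooth)
    (hy : y ∈ (extChartAt 𝓘(ℝ, E) x₀).target) :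
    α.extDeriv.inChart x₀ y = _root_.extDeriv (α.inChart x₀) y := by
  set x₁ := (extChartAt 𝓘(ℝ, E) x₀).symm y
  have hy₁ : x₁ ∈ (extChartAt 𝓘(ℝ, E) x₁).source := mem_extChartAt_source x₁
  have pullback : α.inChart x₀ =ᶠ[𝓝 y] fun z => (α.inChart x₁
      (transition x₀ x₁ z)).compContinuousLinearMap (fderiv ℝ (transition x₀ x₁ : E → E) z) := by
    filter_upwards [(isOpen_extChartAt_target x₀).mem_nhds hy,
      (mdifferentiableAt_extChartAt_symm hy).continuousAt.preimage_mem_nhds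
        ((isOpen_extChartAt_source x₁).mem_nhds hy₁)] with z hz hz₁
    exact α.inChart_transition hz hz₁
  rw [pullback.extDeriv_eq, extDeriv_pullback (f := transition x₀ x₁) (r := ∞)
    (hα.differentiableAt_inChart ((extChartAt 𝓘(ℝ, E) x₁).map_source hy₁))
    (contDiffAt_transition hy hy₁) minSmoothness_two_le_infty]
  ext u
  exact congrArg (_root_.extDeriv (α.inChart x₁) (transition x₀ x₁ y))
    (funext fun i => (fderiv_transition hy hy₁ (u i)).symm)

lemma Form.IsSmooth.extDeriv {α : Form E X k} (hα : α.IsSmooth) : α.extDeriv.IsSmooth :=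
  fun x₀ => (contDiffOn_extDeriv (hα x₀) (isOpen_extChartAt_target x₀) (by simp)).congr
    fun _ hy => hα.inChart_extDeriv hy

lemma Form.IsSmooth.extDeriv_extDeriv {α : Form E X k} (hα : α.IsSmooth) :
    α.extDeriv.extDeriv = 0 := by
  refine Form.ext_inChart fun x => ?_
  have hx := mem_extChartAt_target (I := 𝓘(ℝ, E)) x
  have target_mem := (isOpen_extChartAt_target (I := 𝓘(ℝ, E)) x).mem_nhds hx
  have inChart : α.extDeriv.inChart x =ᶠ[𝓝 (extChartAt 𝓘(ℝ, E) x x)]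
      _root_.extDeriv (α.inChart x) := by
    filter_upwards [target_mem] with z hz using hα.inChart_extDeriv hz
  rw [hα.extDeriv.inChart_extDeriv hx, inChart.extDeriv_eq,
    extDeriv_extDeriv_apply ((hα x).contDiffAt target_mem) minSmoothness_two_le_infty]
  rfl

end Form

section Function

variable (E) in
/-- A smooth function, as a 0-form. -/
def ofFun : SmoothFun E X →ₗ[ℝ] Form E X 0 where
  toFun f x := constOfIsEmpty ℝ (TangentSpace 𝓘(ℝ, E) x) (Fin 0) (f x)
  map_add' _ _ := by ext; rfl
  map_smul' _ _ := by ext; rfl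

@[simp]
lemma value_ofFun (f : SmoothFun E X) (x : X) : (ofFun E f).value x = f x := rfl

lemma ofFun_injective : Function.Injective (ofFun E (X := X)) := fun f g h => by
  ext x
  rw [← value_ofFun, h, value_ofFun]

lemma Form.IsSmooth.contMDiff_value {α : Form E X 0} (hα : α.IsSmooth) :
    ContMDiff 𝓘(ℝ, E) 𝓘(ℝ, ℝ) ∞ α.value := fun x => by
  have value_symm : ContDiffOn ℝ ∞ (α.value ∘ (extChartAt 𝓘(ℝ, E) x).symm)
      (extChartAt 𝓘(ℝ, E) x).target :=
    ((constOfIsEmptyLIE ℝ E ℝ (Fin 0)).symm.contDiff.comp_contDiffOn (hα x)).congr fun y _ =>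
      congrArg (α ((extChartAt 𝓘(ℝ, E) x).symm y) : (Fin 0 → E) → ℝ) (Subsingleton.elim _ _)
  refine (((contMDiffOn_iff_contDiffOn.2 value_symm).contMDiffAt ((isOpen_extChartAt_target
    x).mem_nhds (mem_extChartAt_target x))).comp x contMDiffAt_extChartAt).congr_of_eventuallyEq ?_
  filter_upwards [extChartAt_source_mem_nhds (I := 𝓘(ℝ, E)) x] with z hz
  exact congrArg α.value ((extChartAt 𝓘(ℝ, E) x).left_inv hz).symm

/-- The smooth function whose 0-form is a given smooth 0-form. -/
def Form.IsSmooth.toSmoothFun {α : Form E X 0} (hα : α.IsSmooth) : SmoothFun E X :=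
  ⟨α.value, hα.contMDiff_value⟩

@[simp]
lemma ofFun_toSmoothFun {α : Form E X 0} (hα : α.IsSmooth) : ofFun E hα.toSmoothFun = α := by
  ext x u
  exact congrArg (α x : (Fin 0 → E) → ℝ) (Subsingleton.elim _ _)

variable [IsManifold 𝓘(ℝ, E) ∞ X]

lemma isSmooth_ofFun (f : SmoothFun E X) : (ofFun E f).IsSmooth :=
  fun x₀ => (constOfIsEmptyLIE ℝ E ℝ (Fin 0)).contDiff.comp_contDiffOn
    (contMDiffOn_iff_contDiffOn.1 (f.contMDiff.comp_contMDiffOn (contMDiffOn_extChartAt_symm x₀)))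

lemma differential_eq_extDeriv (f : SmoothFun E X) : differential f = (ofFun E f).extDeriv := by
  refine Form.ext_inChart fun x => ?_
  have hx := mem_extChartAt_target (I := 𝓘(ℝ, E)) x
  have chain := mfderiv_comp (extChartAt 𝓘(ℝ, E) x x) (f.contMDiff.mdifferentiableAt (by simp))
    (mdifferentiableAt_extChartAt_symm hx)
  rw [mfderiv_eq_fderiv] at chain
  rw [(isSmooth_ofFun f).inChart_extDeriv hx]
  refine Eq.trans ?_ (extDeriv_constOfIsEmpty (f ∘ (extChartAt 𝓘(ℝ, E) x).symm) _).symm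
  ext u
  exact congrArg (fun T : E →L[ℝ] ℝ => T (u 0)) chain.symm

end Function

section VField

variable [IsManifold 𝓘(ℝ, E) ∞ X]

namespace VField

lemma add_interior (v w : VField E X) (α : Form E X (k + 1)) :
    (v + w).interior α = v.interior α + w.interior α :=
  funext fun x => map_add (curryLeft (E := E) (α x)) (v x) (w x)

lemma smul_interior (c : ℝ) (v : VField E X) (α : Form E X (k + 1)) :
    (c • v).interior α = c • v.interior α :=
  funext fun x => map_smul (curryLeft (E := E) (α x)) c (v x)

@[simp]
lemma zero_interior (α : Form E X (k + 1)) : (0 : VField E X).interior α = 0 :=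
  funext fun x => map_zero (curryLeft (E := E) (α x))

@[simp]
lemma interior_zero (v : VField E X) : v.interior (0 : Form E X (k + 1)) = 0 := rfl

lemma interior_add (v : VField E X) (α β : Form E X (k + 1)) :
    v.interior (α + β) = v.interior α + v.interior β := rfl

lemma interior_sub (v : VField E X) (α β : Form E X (k + 1)) :
    v.interior (α - β) = v.interior α - v.interior β := rfl

lemma interior_smul (v : VField E X) (c : ℝ) (α : Form E X (k + 1)) :
    v.interior (c • α) = c • v.interior α := rfl

lemma interior_neg (v : VField E X) (α : Form E X (k + 1)) :
    v.interior (-α) = -v.interior α := rfl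

lemma interior_interior_swap (v w : VField E X) (α : Form E X (k + 2)) :
    v.interior (w.interior α) = -w.interior (v.interior α) :=
  funext fun x => curryLeft_curryLeft_swap (E := E) (α x) (w x) (v x)

variable {x₀ : X} {y : E}

lemma mfderiv_inChart (v : VField E X) (hy : y ∈ (extChartAt 𝓘(ℝ, E) x₀).target) :
    mfderiv 𝓘(ℝ, E) 𝓘(ℝ, E) (extChartAt 𝓘(ℝ, E) x₀).symm y (v.inChart x₀ y) =
      v ((extChartAt 𝓘(ℝ, E) x₀).symm y) :=
  (isInvertible_mfderiv_extChartAt_symm hy).self_apply_inverse _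

lemma inChart_interior (v : VField E X) (α : Form E X (k + 1))
    (hy : y ∈ (extChartAt 𝓘(ℝ, E) x₀).target) :
    (v.interior α).inChart x₀ y = curryLeft (α.inChart x₀ y) (v.inChart x₀ y) := by
  ext u
  refine congrArg (α ((extChartAt 𝓘(ℝ, E) x₀).symm y) : (Fin (k + 1) → E) → ℝ) (funext fun i => ?_)
  cases i using Fin.cases with
  | zero => exact (v.mfderiv_inChart hy).symm
  | succ => rfl

lemma inChart_interior_eventuallyEq (v : VField E X) (α : Form E X (k + 1))
    (hy : y ∈ (extChartAt 𝓘(ℝ, E) x₀).target) :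
    (v.interior α).inChart x₀ =ᶠ[𝓝 y] fun z => curryLeft (α.inChart x₀ z) (v.inChart x₀ z) := by
  filter_upwards [(isOpen_extChartAt_target x₀).mem_nhds hy] with z hz
  exact v.inChart_interior α hz

variable [CompleteSpace E]

lemma contDiffOn_inChart (v : VField E X) (x₀ : X) :
    ContDiffOn ℝ ∞ (v.inChart x₀) (extChartAt 𝓘(ℝ, E) x₀).target := fun y hy => by
  have : IsManifold 𝓘(ℝ, E) (∞ + 1) X := inferInstanceAs (IsManifold 𝓘(ℝ, E) ∞ X)
  exact (contMDiffAt_vectorSpace_iff_contDiffAt.1 (ContMDiffAt.mpullback_vectorField_preimage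
    (n := ∞) (v.contMDiff _) (contMDiffAt_extChartAt_symm hy)
    (isInvertible_mfderiv_extChartAt_symm hy) (by simp))).contDiffWithinAt

lemma differentiableAt_inChart (v : VField E X) (hy : y ∈ (extChartAt 𝓘(ℝ, E) x₀).target) :
    DifferentiableAt ℝ (v.inChart x₀) y :=
  ((v.contDiffOn_inChart x₀).contDiffAt
    ((isOpen_extChartAt_target x₀).mem_nhds hy)).differentiableAt (by simp)

end VField

variable [CompleteSpace E]

lemma Form.IsSmooth.interior {α : Form E X (k + 1)} (hα : α.IsSmooth) (v : VField E X) :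
    (v.interior α).IsSmooth := fun x₀ =>
  (contDiffOn_curryLeft (hα x₀) (v.contDiffOn_inChart x₀)).congr fun _ hy =>
    v.inChart_interior α hy

namespace VField

/-- The Lie bracket of smooth vector fields. -/
def bracket (v w : VField E X) : VField E X where
  toFun := mlieBracket 𝓘(ℝ, E) v w
  contMDiff_toFun x := by
    have : IsManifold 𝓘(ℝ, E) ((⊤ : ℕ∞) + 1) X := inferInstanceAs (IsManifold 𝓘(ℝ, E) ∞ X)
    have : IsManifold 𝓘(ℝ, E) (minSmoothness ℝ 2) X := .of_le minSmoothness_two_le_infty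
    exact ContMDiffAt.mlieBracket_vectorField (m := ⊤) (n := ⊤) (v.contMDiff x) (w.contMDiff x)
      (by simp)

variable {x₀ : X} {y : E}

lemma inChart_bracket (v w : VField E X) (hy : y ∈ (extChartAt 𝓘(ℝ, E) x₀).target) :
    (v.bracket w).inChart x₀ y = lieBracket ℝ (v.inChart x₀) (w.inChart x₀) y := by
  have : IsManifold 𝓘(ℝ, E) (∞ + 1) X := inferInstanceAs (IsManifold 𝓘(ℝ, E) ∞ X)
  have : IsManifold 𝓘(ℝ, E) (minSmoothness ℝ 2) X := .of_le minSmoothness_two_le_infty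
  refine (mpullback_mlieBracket (n := ∞) ((v.contMDiff _).mdifferentiableAt (by simp))
    ((w.contMDiff _).mdifferentiableAt (by simp)) (contMDiffAt_extChartAt_symm hy)
    minSmoothness_two_le_infty).trans ?_
  rw [← mlieBracketWithin_univ, mlieBracketWithin_eq_lieBracketWithin]
  exact congrFun lieBracketWithin_univ y

omit [CompleteSpace E] in
/-- The Lie derivative of a differential form of any degree, defined by Cartan's formula
`L_v = ι_v d + d ι_v`. -/
def lie (v : VField E X) : {k : ℕ} → Form E X k → Form E X k
  | 0, α => v.interior α.extDeriv
  | _ + 1, α => v.interior α.extDeriv + (v.interior α).extDeriv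

omit [CompleteSpace E] in
lemma value_lie_ofFun (v : VField E X) (f : SmoothFun E X) (x : X) :
    (v.lie (ofFun E f)).value x = v.lieDerivFun f x := by
  rw [lie, ← differential_eq_extDeriv]
  rfl

omit [CompleteSpace E] in
@[simp]
lemma zero_lie (α : Form E X k) : (0 : VField E X).lie α = 0 := by
  cases k with
  | zero => rw [lie, zero_interior]
  | succ k => rw [lie, zero_interior, zero_interior, extDeriv_zero, add_zero]

omit [CompleteSpace E] in
lemma lie_smul (v : VField E X) (c : ℝ) (α : Form E X k) : v.lie (c • α) = c • v.lie α := by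
  cases k with
  | zero => rw [lie, extDeriv_smul]; rfl
  | succ k => simp only [lie, extDeriv_smul, interior_smul, smul_add]

omit [CompleteSpace E] in
lemma lie_neg (v : VField E X) (α : Form E X k) : v.lie (-α) = -v.lie α :=
  (congrArg v.lie (neg_one_smul ℝ α).symm).trans <|
    (v.lie_smul (-1) α).trans (neg_one_smul ℝ (v.lie α))

omit [CompleteSpace E] in
lemma smul_lie (c : ℝ) (v : VField E X) (α : Form E X k) : (c • v).lie α = c • v.lie α := by
  cases k with
  | zero => rw [lie, smul_interior, lie]
  | succ k => simp only [lie, smul_interior, extDeriv_smul, smul_add]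

lemma add_lie (v w : VField E X) {α : Form E X k} (hα : α.IsSmooth) :
    (v + w).lie α = v.lie α + w.lie α := by
  cases k with
  | zero => rw [lie, add_interior, lie, lie]
  | succ k =>
    simp only [lie, add_interior, extDeriv_add (hα.interior v) (hα.interior w)]
    abel

lemma inChart_lie (v : VField E X) {α : Form E X k} (hα : α.IsSmooth)
    (hy : y ∈ (extChartAt 𝓘(ℝ, E) x₀).target) :
    (v.lie α).inChart x₀ y = flatLieDeriv (v.inChart x₀) (α.inChart x₀) y := by
  cases k with
  | zero =>
    rw [lie, inChart_interior v _ hy, hα.inChart_extDeriv hy, flatLieDeriv_eq_curryLeft_extDeriv]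
  | succ k =>
    rw [lie, inChart_add, Pi.add_apply, inChart_interior v _ hy, hα.inChart_extDeriv hy,
      (hα.interior v).inChart_extDeriv hy, (inChart_interior_eventuallyEq v α hy).extDeriv_eq,
      flatLieDeriv_eq_add (hα.differentiableAt_inChart hy) (v.differentiableAt_inChart hy)]

lemma lieDeriv_eq_lie (v : VField E X) {α : Form E X 1} (hα : α.IsSmooth) :
    v.lieDeriv α = v.lie α := by
  have slot (T : E [⋀^Fin 1]→L[ℝ] ℝ) (A : E →L[ℝ] E) :
      T.fderivCompContinuousLinearMap (.id ℝ E) A = T.compContinuousLinearMap A := by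
    ext u
    simp [fderivCompContinuousLinearMap_apply, Function.comp_def, Subsingleton.elim _ (0 : Fin 1)]
  funext x
  rw [(v.lie α).apply_eq_inChart, inChart_lie v hα (mem_extChartAt_target x), flatLieDeriv, slot]
  rfl

lemma lie_add (v : VField E X) {α β : Form E X k} (hα : α.IsSmooth) (hβ : β.IsSmooth) :
    v.lie (α + β) = v.lie α + v.lie β := by
  cases k with
  | zero => rw [lie, extDeriv_add hα hβ]; rfl
  | succ k =>
    simp only [lie, extDeriv_add hα hβ, interior_add, extDeriv_add (hα.interior v) (hβ.interior v)]
    abel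

end VField

lemma Form.IsSmooth.lie {α : Form E X k} (hα : α.IsSmooth) (v : VField E X) :
    (v.lie α).IsSmooth := by
  cases k with
  | zero => exact hα.extDeriv.interior v
  | succ k => exact (hα.extDeriv.interior v).add (hα.interior v).extDeriv

namespace VField

lemma lie_extDeriv (v : VField E X) {α : Form E X k} (hα : α.IsSmooth) :
    v.lie α.extDeriv = (v.lie α).extDeriv := by
  cases k with
  | zero =>
    rw [lie, lie, hα.extDeriv_extDeriv, interior_zero]
    exact zero_add _
  | succ k =>
    rw [lie, hα.extDeriv_extDeriv, interior_zero, zero_add, lie,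
      extDeriv_add (hα.extDeriv.interior v) (hα.interior v).extDeriv,
      (hα.interior v).extDeriv_extDeriv, add_zero]

lemma lie_interior (v w : VField E X) {α : Form E X (k + 1)} (hα : α.IsSmooth) :
    v.lie (w.interior α) = (v.bracket w).interior α + w.interior (v.lie α) := by
  refine Form.ext_inChart fun x => ?_
  have hx := mem_extChartAt_target (I := 𝓘(ℝ, E)) x
  have interior_eq := inChart_interior_eventuallyEq w α hx
  rw [inChart_lie v (hα.interior w) hx, flatLieDeriv, interior_eq.fderiv_eq, interior_eq.eq_of_nhds,
    inChart_add, Pi.add_apply, inChart_interior _ _ hx, inChart_interior _ _ hx,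
    inChart_lie v hα hx, inChart_bracket v w hx,
    ← flatLieDeriv_curryLeft (hα.differentiableAt_inChart hx) (w.differentiableAt_inChart hx),
    flatLieDeriv]

lemma lie_lie (v w : VField E X) {α : Form E X k} (hα : α.IsSmooth) :
    v.lie (w.lie α) = (v.bracket w).lie α + w.lie (v.lie α) := by
  cases k with
  | zero =>
    change v.lie (w.interior α.extDeriv) = _
    rw [lie_interior v w hα.extDeriv, lie_extDeriv v hα]
    rfl
  | succ k =>
    have hw := (hα.interior w).extDeriv
    calc v.lie (w.interior α.extDeriv + (w.interior α).extDeriv)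
        = v.lie (w.interior α.extDeriv) + (v.lie (w.interior α)).extDeriv := by
          rw [lie_add v (hα.extDeriv.interior w) hw, lie_extDeriv v (hα.interior w)]
      _ = (v.bracket w).interior α.extDeriv + w.interior (v.lie α).extDeriv
          + (((v.bracket w).interior α).extDeriv + (w.interior (v.lie α)).extDeriv) := by
          rw [lie_interior v w hα.extDeriv, lie_extDeriv v hα, lie_interior v w hα,
            extDeriv_add (hα.interior _) ((hα.lie v).interior w)]
      _ = (v.bracket w).lie α + w.lie (v.lie α) := by
          simp only [lie]
          abel

end VField
end VField

/-! ### Hamiltonian forms -/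

variable [IsManifold 𝓘(ℝ, E) ∞ X] {Ω : Form E X 3}

lemma isHamiltonianVF_hamVF (F : Ham Ω) : IsHamiltonianVF Ω (F : Form E X 1) (hamVF F) :=
  F.2.2.choose_spec

lemma interior_hamVF_extDeriv (F G : Ham Ω) :
    (hamVF F).interior (G : Form E X 1).extDeriv =
      (hamVF G).interior ((hamVF F).interior Ω) := by
  rw [isHamiltonianVF_hamVF G, VField.interior_neg, VField.interior_interior_swap, neg_neg]

lemma interior_hamVF_extDeriv_swap (F G : Ham Ω) :
    (hamVF F).interior (G : Form E X 1).extDeriv =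
      -(hamVF G).interior (F : Form E X 1).extDeriv := by
  rw [interior_hamVF_extDeriv, interior_hamVF_extDeriv, VField.interior_interior_swap]

lemma IsHamiltonianVF.lie_eq_zero {F : Form E X 1} {v : VField E X} (hv : IsHamiltonianVF Ω F v)
    (hF : F.IsSmooth) (closed : Ω.extDeriv = 0) : v.lie Ω = 0 := by
  rw [VField.lie, closed, VField.interior_zero, zero_add, ← neg_eq_zero, ← extDeriv_neg, ← hv,
    hF.extDeriv_extDeriv]

/-- The exact 1-form of a smooth function, as a Hamiltonian form. -/
def hamDifferential (Ω : Form E X 3) : SmoothFun E X →ₗ[ℝ] Ham Ω where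
  toFun f := ⟨(ofFun E f).extDeriv, (isSmooth_ofFun f).extDeriv, 0, by
    rw [IsHamiltonianVF, (isSmooth_ofFun f).extDeriv_extDeriv, VField.zero_interior, neg_zero]⟩
  map_add' f g := Subtype.ext <|
    (congrArg Form.extDeriv (map_add (ofFun E) f g)).trans
      (extDeriv_add (isSmooth_ofFun f) (isSmooth_ofFun g))
  map_smul' c f := Subtype.ext <|
    (congrArg Form.extDeriv (map_smul (ofFun E) c f)).trans (extDeriv_smul c _)

@[simp]
lemma coe_hamDifferential (f : SmoothFun E X) :
    (hamDifferential Ω f : Form E X 1) = (ofFun E f).extDeriv := rfl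

section CompleteSpace

variable [CompleteSpace E]

lemma IsHamiltonianVF.lie {F G : Form E X 1} {v w : VField E X} (hv : IsHamiltonianVF Ω F v)
    (hw : IsHamiltonianVF Ω G w) (hF : F.IsSmooth) (hG : G.IsSmooth) (smooth : Ω.IsSmooth)
    (closed : Ω.extDeriv = 0) : IsHamiltonianVF Ω (v.lie G) (v.bracket w) :=
  calc (v.lie G).extDeriv = v.lie (-w.interior Ω) := by rw [← v.lie_extDeriv hG, hw]
    _ = -((v.bracket w).interior Ω + w.interior (v.lie Ω)) := by
        rw [v.lie_neg, v.lie_interior w smooth]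
    _ = -(v.bracket w).interior Ω := by
        rw [hv.lie_eq_zero hF closed, VField.interior_zero, add_zero]

end CompleteSpace

namespace IsTwoPlectic

lemma hamVF_eq (hΩ : IsTwoPlectic Ω) {F : Ham Ω} {v : VField E X}
    (hv : IsHamiltonianVF Ω (F : Form E X 1) v) : hamVF F = v := by
  have interior_eq : (hamVF F).interior Ω = v.interior Ω := by
    rw [← neg_inj, ← isHamiltonianVF_hamVF, hv]
  ext x
  refine sub_eq_zero.1 (hΩ.nondegenerate x _ ?_)
  exact (map_sub (curryLeft (E := E) (Ω x)) _ _).trans (sub_eq_zero.2 (congrFun interior_eq x))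

lemma hamVF_add (hΩ : IsTwoPlectic Ω) (F G : Ham Ω) : hamVF (F + G) = hamVF F + hamVF G := by
  refine hΩ.hamVF_eq ?_
  rw [IsHamiltonianVF, Submodule.coe_add, extDeriv_add F.2.1 G.2.1, isHamiltonianVF_hamVF,
    isHamiltonianVF_hamVF, VField.add_interior, neg_add]

lemma hamVF_smul (hΩ : IsTwoPlectic Ω) (c : ℝ) (F : Ham Ω) : hamVF (c • F) = c • hamVF F := by
  refine hΩ.hamVF_eq ?_
  rw [IsHamiltonianVF, Submodule.coe_smul, extDeriv_smul, isHamiltonianVF_hamVF,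
    VField.smul_interior, smul_neg]

lemma hamVF_hamDifferential (hΩ : IsTwoPlectic Ω) (f : SmoothFun E X) :
    hamVF (hamDifferential Ω f) = 0 :=
  hΩ.hamVF_eq <| by
    rw [IsHamiltonianVF, coe_hamDifferential, (isSmooth_ofFun f).extDeriv_extDeriv,
      VField.zero_interior, neg_zero]

variable [CompleteSpace E]

/-- The Lie derivative `L_{v_F} G` of Hamiltonian forms. -/
def lieHam (hΩ : IsTwoPlectic Ω) : Ham Ω →ₗ[ℝ] Ham Ω →ₗ[ℝ] Ham Ω :=
  LinearMap.mk₂ ℝ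
    (fun F G => ⟨(hamVF F).lie (G : Form E X 1), G.2.1.lie _, _, (isHamiltonianVF_hamVF F).lie
      (isHamiltonianVF_hamVF G) F.2.1 G.2.1 hΩ.smooth hΩ.closed⟩)
    (fun F F' G => Subtype.ext <| by simp [hΩ.hamVF_add, VField.add_lie _ _ G.2.1])
    (fun c F G => Subtype.ext <| by simp [hΩ.hamVF_smul, VField.smul_lie])
    (fun F G G' => Subtype.ext <| VField.lie_add _ G.2.1 G'.2.1)
    (fun c F G => Subtype.ext <| VField.lie_smul _ c _)

@[simp]
lemma coe_lieHam (hΩ : IsTwoPlectic Ω) (F G : Ham Ω) :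
    (hΩ.lieHam F G : Form E X 1) = (hamVF F).lie (G : Form E X 1) := rfl

lemma hamVF_lieHam (hΩ : IsTwoPlectic Ω) (F G : Ham Ω) :
    hamVF (hΩ.lieHam F G) = (hamVF F).bracket (hamVF G) :=
  hΩ.hamVF_eq ((isHamiltonianVF_hamVF F).lie (isHamiltonianVF_hamVF G) F.2.1 G.2.1 hΩ.smooth
    hΩ.closed)

/-- The Lie derivative `L_{v_F} f` of functions. -/
def lieFun (hΩ : IsTwoPlectic Ω) : Ham Ω →ₗ[ℝ] SmoothFun E X →ₗ[ℝ] SmoothFun E X :=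
  LinearMap.mk₂ ℝ (fun F f => ((isSmooth_ofFun f).lie (hamVF F)).toSmoothFun)
    (fun F F' f => ofFun_injective <| by
      simp [hΩ.hamVF_add, VField.add_lie _ _ (isSmooth_ofFun f)])
    (fun c F f => ofFun_injective <| by simp [hΩ.hamVF_smul, VField.smul_lie])
    (fun F f g => ofFun_injective <| by
      simp [VField.lie_add _ (isSmooth_ofFun f) (isSmooth_ofFun g)])
    (fun c F f => ofFun_injective <| by simp [VField.lie_smul])

@[simp]
lemma ofFun_lieFun (hΩ : IsTwoPlectic Ω) (F : Ham Ω) (f : SmoothFun E X) :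
    ofFun E (hΩ.lieFun F f) = (hamVF F).lie (ofFun E f) := by
  simp [lieFun]

/-- The function `ι_{v_F} G`. -/
def contraction (hΩ : IsTwoPlectic Ω) : Ham Ω →ₗ[ℝ] Ham Ω →ₗ[ℝ] SmoothFun E X :=
  LinearMap.mk₂ ℝ (fun F G => (G.2.1.interior (hamVF F)).toSmoothFun)
    (fun F F' G => ofFun_injective <| by simp [hΩ.hamVF_add, VField.add_interior])
    (fun c F G => ofFun_injective <| by simp [hΩ.hamVF_smul, VField.smul_interior])
    (fun F G G' => rfl)
    (fun c F G => rfl)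

@[simp]
lemma ofFun_contraction (hΩ : IsTwoPlectic Ω) (F G : Ham Ω) :
    ofFun E (hΩ.contraction F G) = (hamVF F).interior (G : Form E X 1) :=
  ofFun_toSmoothFun (G.2.1.interior (hamVF F))

lemma hamDifferential_contraction (hΩ : IsTwoPlectic Ω) (F G : Ham Ω) :
    (hamDifferential Ω (hΩ.contraction F G) : Form E X 1) =
      (hamVF F).lie (G : Form E X 1) - (hamVF F).interior (G : Form E X 1).extDeriv := by
  rw [coe_hamDifferential, ofFun_contraction, VField.lie, add_sub_cancel_left]

@[simp]
lemma contraction_hamDifferential_left (hΩ : IsTwoPlectic Ω) (f : SmoothFun E X) (G : Ham Ω) :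
    hΩ.contraction (hamDifferential Ω f) G = 0 :=
  ofFun_injective <| by simp [hΩ.hamVF_hamDifferential]

@[simp]
lemma contraction_hamDifferential_right (hΩ : IsTwoPlectic Ω) (F : Ham Ω) (f : SmoothFun E X) :
    hΩ.contraction F (hamDifferential Ω f) = hΩ.lieFun F f :=
  ofFun_injective <| by simp [VField.lie]

lemma lieFun_contraction (hΩ : IsTwoPlectic Ω) (F G H : Ham Ω) :
    hΩ.lieFun F (hΩ.contraction G H) =
      hΩ.contraction (hΩ.lieHam F G) H + hΩ.contraction G (hΩ.lieHam F H) :=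
  ofFun_injective <| by simp [hΩ.hamVF_lieHam, VField.lie_interior _ _ H.2.1]

/-- The hemistrict Lie 2-algebra of a 2-plectic manifold. -/
@[simps]
def hemistrict (hΩ : IsTwoPlectic Ω) : Lie2Algebra ℝ (Ham Ω) (SmoothFun E X) where
  d := hamDifferential Ω
  br00 := hΩ.lieHam
  br01 := hΩ.lieFun
  br10 := 0
  S := -(hΩ.contraction + hΩ.contraction.flip)
  J := 0
  d_br01 F f := Subtype.ext <| by simp [VField.lie_extDeriv _ (isSmooth_ofFun f)]
  d_br10 f G := Subtype.ext <| by simp [hΩ.hamVF_hamDifferential]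
  br_d_d f g := ofFun_injective <| by simp [hΩ.hamVF_hamDifferential]
  S00 F G := Subtype.ext <| by
    simp only [LinearMap.neg_apply, LinearMap.add_apply, LinearMap.flip_apply, map_neg, map_add,
      Submodule.coe_add, Submodule.coe_neg, hamDifferential_contraction, coe_lieHam,
      interior_hamVF_extDeriv_swap G F]
    abel
  S01 F g := by simp
  S10 f G := by simp
  J000 F G H := Subtype.ext <| by
    simpa [hΩ.hamVF_lieHam] using VField.lie_lie (hamVF F) (hamVF G) H.2.1
  J001 F G h := ofFun_injective <| by
    simpa [hΩ.hamVF_lieHam] using VField.lie_lie (hamVF F) (hamVF G) (isSmooth_ofFun h)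
  J010 := by simp
  J100 := by simp
  J_swap_left := by simp
  J_swap_right := by simp
  coh_JJ := by simp
  coh_SJ_left := by simp
  coh_SJ_right F G H := by
    simp only [LinearMap.neg_apply, LinearMap.add_apply, LinearMap.flip_apply, map_neg, map_add,
      lieFun_contraction, LinearMap.zero_apply]
    abel
  coh_SS F G H := by
    simp only [LinearMap.neg_apply, LinearMap.add_apply, LinearMap.flip_apply]
    abel

lemma twistJ_hemistrict (hΩ : IsTwoPlectic Ω) (F G H : Ham Ω) :
    ofFun E (hΩ.hemistrict.twistJ hΩ.contraction F G H) =
      -(hamVF F).interior ((hamVF G).interior ((hamVF H).interior Ω)) := by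
  have cartan : hΩ.hemistrict.twistJ hΩ.contraction F G H =
      hΩ.contraction F (hΩ.lieHam G H) -
        hΩ.contraction F (hamDifferential Ω (hΩ.contraction G H)) := by
    rw [contraction_hamDifferential_right, lieFun_contraction]
    simp only [Lie2Algebra.twistJ_apply, Lie2Algebra.twistBr01_apply,
      Lie2Algebra.twistBr10_apply, hemistrict_d, hemistrict_br00, hemistrict_br01,
      hemistrict_br10, hemistrict_J, LinearMap.zero_apply, contraction_hamDifferential_left,
      contraction_hamDifferential_right, lieFun_contraction]
    abel
  calc ofFun E (hΩ.hemistrict.twistJ hΩ.contraction F G H)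
      = (hamVF F).interior ((hamVF G).lie H) -
          (hamVF F).interior ((hamVF G).lie H - (hamVF G).interior (H : Form E X 1).extDeriv) := by
        rw [cartan, map_sub, ofFun_contraction, ofFun_contraction, coe_lieHam,
          hamDifferential_contraction]
    _ = (hamVF F).interior ((hamVF G).interior (H : Form E X 1).extDeriv) := by
        rw [← VField.interior_sub, sub_sub_cancel]
    _ = -(hamVF F).interior ((hamVF G).interior ((hamVF H).interior Ω)) := by
        rw [isHamiltonianVF_hamVF H, VField.interior_neg, VField.interior_neg]

lemma twistJ_hemistrict_swap_left (hΩ : IsTwoPlectic Ω) (F G H : Ham Ω) :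
    hΩ.hemistrict.twistJ hΩ.contraction G F H = -hΩ.hemistrict.twistJ hΩ.contraction F G H :=
  ofFun_injective <| by
    rw [map_neg, twistJ_hemistrict, twistJ_hemistrict, VField.interior_interior_swap]

lemma twistJ_hemistrict_swap_right (hΩ : IsTwoPlectic Ω) (F G H : Ham Ω) :
    hΩ.hemistrict.twistJ hΩ.contraction F H G = -hΩ.hemistrict.twistJ hΩ.contraction F G H :=
  ofFun_injective <| by
    rw [map_neg, twistJ_hemistrict, twistJ_hemistrict, VField.interior_interior_swap (hamVF H),
      VField.interior_neg]

/-- The semistrict Lie 2-algebra of a 2-plectic manifold, obtained from the hemistrict one by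
transport along `ι_{v_F} G`. -/
def semistrict (hΩ : IsTwoPlectic Ω) : Lie2Algebra ℝ (Ham Ω) (SmoothFun E X) :=
  hΩ.hemistrict.twist hΩ.contraction hΩ.twistJ_hemistrict_swap_left hΩ.twistJ_hemistrict_swap_right

lemma isHemistrictLie2_hemistrict (hΩ : IsTwoPlectic Ω) : IsHemistrictLie2 Ω hΩ.hemistrict where
  d_eq f := (differential_eq_extDeriv f).symm
  br00_eq F G := ((hamVF F).lieDeriv_eq_lie G.2.1).symm
  br01_eq F f x := (hamVF F).value_lie_ofFun f x
  br10_eq _ _ := rfl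
  S_eq _ _ _ := rfl
  J_eq _ _ _ := rfl

lemma isSemistrictLie2_semistrict (hΩ : IsTwoPlectic Ω) : IsSemistrictLie2 Ω hΩ.semistrict where
  d_eq f := (differential_eq_extDeriv f).symm
  br00_eq F G := by
    rw [semistrict, Lie2Algebra.twist_br00, Lie2Algebra.twistBr00_apply, hemistrict_br00,
      hemistrict_d, Submodule.coe_sub, hamDifferential_contraction, coe_lieHam, sub_sub_cancel,
      interior_hamVF_extDeriv]
  br01_eq F f := by simp [semistrict]
  br10_eq f F := by simp [semistrict]
  S_eq F G := by
    simp only [semistrict, Lie2Algebra.twist_S, hemistrict_S, LinearMap.add_apply,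
      LinearMap.neg_apply, LinearMap.flip_apply]
    abel
  J_eq F G H x := congrArg (fun α : Form E X 0 => α.value x) (hΩ.twistJ_hemistrict F G H)

end IsTwoPlectic
end TwoPlectic
end

open TwoPlectic in
theorem theorem4p6_general {E : Type*} [NormedAddCommGroup E] [NormedSpace ℝ E] [CompleteSpace E]
    {X : Type*} [TopologicalSpace X] [ChartedSpace E X] [IsManifold 𝓘(ℝ, E) ∞ X]
    (Ω : Form E X 3) (hΩ : IsTwoPlectic Ω) :
    ∃ Lh Ls : Lie2Algebra ℝ (Ham Ω) (SmoothFun E X),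
      IsHemistrictLie2 Ω Lh ∧ IsSemistrictLie2 Ω Ls ∧
      ∃ (φ : Lie2Algebra.Hom Lh Ls) (ψ : Lie2Algebra.Hom Ls Lh),
        φ.f₀ = LinearMap.id ∧ φ.f₁ = LinearMap.id ∧
        (∀ (F G : Ham Ω) (x : X),
          φ.Φ F G x = ((hamVF F).interior (G : Form E X 1)).value x) ∧
        ψ.f₀ = LinearMap.id ∧ ψ.f₁ = LinearMap.id ∧
        ψ.comp φ = Lie2Algebra.Hom.id Lh ∧
        φ.comp ψ = Lie2Algebra.Hom.id Ls :=
  have swap_left := hΩ.twistJ_hemistrict_swap_left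
  have swap_right := hΩ.twistJ_hemistrict_swap_right
  ⟨hΩ.hemistrict, hΩ.semistrict, hΩ.isHemistrictLie2_hemistrict, hΩ.isSemistrictLie2_semistrict,
    Lie2Algebra.toTwist swap_left swap_right, Lie2Algebra.ofTwist swap_left swap_right,
    rfl, rfl, fun _ _ _ => rfl, rfl, rfl, Lie2Algebra.ofTwist_comp_toTwist swap_left swap_right,
    Lie2Algebra.toTwist_comp_ofTwist swap_left swap_right⟩

open TwoPlectic in
theorem theorem4p6 {E : Type*} [NormedAddCommGroup E] [NormedSpace ℝ E] [FiniteDimensional ℝ E]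
    {X : Type*} [TopologicalSpace X] [T2Space X] [ChartedSpace E X] [IsManifold 𝓘(ℝ, E) ∞ X]
    (Ω : Form E X 3) (hΩ : IsTwoPlectic Ω) :
    ∃ Lh Ls : Lie2Algebra ℝ (Ham Ω) (SmoothFun E X),
      IsHemistrictLie2 Ω Lh ∧ IsSemistrictLie2 Ω Ls ∧
      ∃ (φ : Lie2Algebra.Hom Lh Ls) (ψ : Lie2Algebra.Hom Ls Lh),
        φ.f₀ = LinearMap.id ∧ φ.f₁ = LinearMap.id ∧
        (∀ (F G : Ham Ω) (x : X),
          φ.Φ F G x = ((hamVF F).interior (G : Form E X 1)).value x) ∧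
        ψ.f₀ = LinearMap.id ∧ ψ.f₁ = LinearMap.id ∧
        ψ.comp φ = Lie2Algebra.Hom.id Lh ∧
        φ.comp ψ = Lie2Algebra.Hom.id Ls := by
  have := FiniteDimensional.complete ℝ E
  exact theorem4p6_general Ω hΩ
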